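/- All graphs are finite and simple. A graph $H$ is a minor of a graph $G$ if $H$ is (up to isomorphism) obtained from a subgraph of $G$ by contracting edges; it is a proper minor if moreover $H$ is not isomorphic to $G$. For an integer $k\ge 1$, a graph $G$ is $k$-contraction-critical if $\chi(G)=k$ and every proper minor of $G$ is $(k-1)$-colorable. $G[S]$ denotes the subgraph of $G$ induced by $S\subseteq V(G)$, and $\alpha$ denotes the independence number. Theorem. Let $k\ge 1$, $t\ge 3$ and $s\ge 0$ be integers with $k\ge s+2^{t-1}-t$, and let $G$ be a $k$-contraction-critical graph. If $S\subseteq V(G)$ satisfies $|S|\le s$ and $\alpha(G[S])\ge |S|-t$, then $G-S$ is connected. -/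

import Mathlib

namespace SimpleGraph

universe u v

/-- The graph obtained from `G` by contracting all edges of `F` (meant for `F ≤ G`): its vertices
are the classes of vertices joined by edges of `F`; two distinct classes are adjacent when some edge
of `G` joins them (loops and parallel edges are discarded). -/
def contractEdges {V : Type u} (G F : SimpleGraph V) : SimpleGraph F.ConnectedComponent where
  Adj c d := c ≠ d ∧
    ∃ x y : V, G.Adj x y ∧ F.connectedComponentMk x = c ∧ F.connectedComponentMk y = d
  symm := ⟨fun _ _ ⟨hne, x, y, hxy, hx, hy⟩ => ⟨hne.symm, y, x, hxy.symm, hy, hx⟩⟩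
  loopless := ⟨fun _ h => h.1 rfl⟩

/-- `H` is a minor of `G`: up to isomorphism, `H` is obtained from a subgraph `K` of `G` by
contracting a set of edges of `K`. -/
def IsMinor {W : Type v} {V : Type u} (H : SimpleGraph W) (G : SimpleGraph V) : Prop :=
  ∃ (K : G.Subgraph) (F : SimpleGraph K.verts),
    F ≤ K.coe ∧ Nonempty (H ≃g contractEdges K.coe F)

/-- `H` is a proper minor of `G`: a minor that is not isomorphic to `G` itself. -/
def IsProperMinor {W : Type v} {V : Type u} (H : SimpleGraph W) (G : SimpleGraph V) : Prop :=
  IsMinor H G ∧ ¬ Nonempty (H ≃g G)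

/-- `G` is `k`-contraction-critical: `G` is `k`-chromatic, but every proper minor of `G` is
`(k - 1)`-colorable. -/
def IsContractionCritical {V : Type u} (G : SimpleGraph V) (k : ℕ) : Prop :=
  G.chromaticNumber = k ∧
    ∀ (W : Type u) (H : SimpleGraph W), IsProperMinor H G → H.Colorable (k - 1)

end SimpleGraph

namespace SimpleGraph

universe u

/-! ### Reachability inside a vertex set -/

variable {V : Type u} {α : Type*}

/-! If `G - S` were disconnected, `G` would be `(k - 1)`-colourable. Take an inclusion-minimal `S₀ ⊆
S` separating two given vertices, and split a nonempty `S₀` into a nonempty independent set `A` and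
a set `T` with at most `t` vertices. By minimality the components `D`, `D'` of the two vertices are
attached to all of `S₀`. Let `M = D ∪ S₀` and `M' = Dᶜ`. Contracting `D' ∪ A` colours `M` with `A`
in one colour `a` that is absent from `T`; contracting `D ∪ A` does the same for `M'`. Among such
colourings choose, on each side, one with the most colours on `T`. If both are injective on `T`,
they induce the same partition of `S₀` and can be glued.

Otherwise let `c`, say on `M`, be non-injective on `T`, and let `P` be its set of colours on `T`. By
maximality every class of `T` lies in a single Kempe chain for each free colour other than `a`
(`IsMonoColoring.reachable_of_max`). Give a distinct free label to each set `U` of at least two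
colours of `P`, and to singletons where needed. For each `U`, either its chains in the label are
pairwise separated, so its classes can be merged into the label by simultaneous swaps, or two of the
chains yield disjoint adjacent pieces (`exists_chain_parts`). Collecting the pieces gives disjoint
connected blocks, one per class of `T` (`exists_blocks`).

Contract the blocks and the components of the rest of `M`, and colour the resulting proper minor by
`c'`. Classes that receive equal colours have no adjacent blocks, so they can be merged; the
contracted components of the rest show how to recolour `A`. Thus `c` becomes a colouring of `M` with
the same partition of `A ∪ T` as `c'` (`IsMonoColoring.exists_transfer`), and the two are glued. The
bound on `k` provides enough colours for `P`, the labels and `A` (`exists_label_family`). -/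

/-- The spanning subgraph of `G` whose edges are the edges of `G` with both ends in `M`. -/
def onSet (G : SimpleGraph V) (M : Set V) : SimpleGraph V where
  Adj u v := G.Adj u v ∧ u ∈ M ∧ v ∈ M
  symm := ⟨fun _ _ h => ⟨h.1.symm, h.2.2, h.2.1⟩⟩
  loopless := ⟨fun _ h => G.loopless.irrefl _ h.1⟩

theorem onSet_mono (G : SimpleGraph V) {M N : Set V} (h : M ⊆ N) : G.onSet M ≤ G.onSet N :=
  fun _ _ huv => ⟨huv.1, h huv.2.1, h huv.2.2⟩

theorem Reachable.of_closed {H : SimpleGraph V} {u v : V} (h : H.Reachable u v) (p : V → Prop)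
    (hu : p u) (hp : ∀ x y, H.Adj x y → p x → p y) : p v := by
  obtain ⟨w⟩ := h
  induction w with
  | nil => exact hu
  | cons hadj _ ih => exact ih (hp _ _ hadj hu)

theorem Reachable.eq_of_adj {H : SimpleGraph V} {u v : V} {β : Type*} (h : H.Reachable u v)
    (f : V → β) (hf : ∀ x y, H.Adj x y → f x = f y) : f u = f v :=
  h.of_closed (fun w => f u = f w) rfl (fun x y hxy hx => hx.trans (hf x y hxy))

/-- The vertices that can be reached from `X` along edges of `G` inside `M`. -/
def reachSet (G : SimpleGraph V) (M X : Set V) : Set V :=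
  {v | ∃ x ∈ X, (G.onSet M).Reachable x v}

theorem subset_reachSet (G : SimpleGraph V) (M X : Set V) : X ⊆ G.reachSet M X :=
  fun x hx => ⟨x, hx, Reachable.refl _⟩

theorem reachSet_subset {G : SimpleGraph V} {M X : Set V} (hX : X ⊆ M) : G.reachSet M X ⊆ M := by
  rintro v ⟨x, hx, h⟩
  exact h.of_closed (· ∈ M) (hX hx) fun _ _ h _ => h.2.2

theorem mem_reachSet_of_adj {G : SimpleGraph V} {M X : Set V} {v w : V}
    (hv : v ∈ G.reachSet M X) (hvM : v ∈ M) (hw : w ∈ M) (h : G.Adj v w) : w ∈ G.reachSet M X := by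
  obtain ⟨x, hx, hr⟩ := hv
  exact ⟨x, hx, hr.trans (Adj.reachable (G := G.onSet M) ⟨h, hvM, hw⟩)⟩

theorem reachable_onSet_reachSet {G : SimpleGraph V} {M X : Set V} {x v : V} (hx : x ∈ X)
    (h : (G.onSet M).Reachable x v) : (G.onSet (G.reachSet M X)).Reachable x v := by
  refine (h.of_closed (fun w => w ∈ G.reachSet M X ∧ (G.onSet (G.reachSet M X)).Reachable x w)
    ⟨subset_reachSet G M X hx, Reachable.refl _⟩ ?_).2
  rintro y z ⟨hyz, hy, hz⟩ ⟨hyr, hr⟩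
  have hzr := mem_reachSet_of_adj hyr hy hz hyz
  exact ⟨hzr, hr.trans (Adj.reachable (G := G.onSet _) ⟨hyz, hyr, hzr⟩)⟩

/-! ### Colourings from proper minors, and gluing -/

/-- Every proper minor obtained by contracting the edges of `F` inside `M` and deleting the vertices
outside `M` gives a colouring that is constant along `F` and otherwise proper on `M`. -/
theorem IsContractionCritical.exists_coloring [Finite V] {G : SimpleGraph V} {k : ℕ}
    (hG : G.IsContractionCritical k) (M : Set V) (F : SimpleGraph V) (hFG : F ≤ G)
    (hFM : ∀ u v, F.Adj u v → u ∈ M) (hne : M ≠ Set.univ ∨ F ≠ ⊥) :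
    ∃ c : V → Option (Fin (k - 1)), (∀ v ∈ M, c v ≠ none) ∧ (∀ u v, F.Adj u v → c u = c v) ∧
      ∀ u ∈ M, ∀ v ∈ M, G.Adj u v → ¬ F.Reachable u v → c u ≠ c v := by
  classical
  let K : G.Subgraph := (⊤ : G.Subgraph).induce M
  let F' : SimpleGraph K.verts := F.comap Subtype.val
  have hF' : F' ≤ K.coe := by
    intro a b hab
    have hab' : F.Adj a.1 b.1 := hab
    simp only [Subgraph.coe_adj, K, Subgraph.induce_adj]
    exact ⟨hFM _ _ hab', hFM _ _ hab'.symm, hFG hab'⟩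
  have hprop : IsProperMinor (contractEdges K.coe F') G := by
    refine ⟨⟨K, F', hF', ⟨Iso.refl⟩⟩, ?_⟩
    rintro ⟨e⟩
    -- An isomorphism would make this quotient map a surjection from `M` onto `V`. By finiteness `M`
    -- is everything and `g` is injective, whereas `g` identifies the ends of every edge of `F`.
    let g : K.verts → V := fun x => e (F'.connectedComponentMk x)
    have hgs : Function.Surjective g := by
      intro v
      obtain ⟨x, hx⟩ := Quot.exists_rep (e.symm v)
      refine ⟨x, ?_⟩
      change e (Quot.mk _ x) = v
      rw [hx]; exact e.apply_symm_apply v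
    have hM : M = Set.univ := by
      have h1 : Nat.card V ≤ Nat.card M := Nat.card_le_card_of_surjective g hgs
      rw [Nat.card_coe_set_eq, ← Set.ncard_univ] at h1
      exact Set.eq_of_subset_of_ncard_le (Set.subset_univ _) h1
    rcases hne with hne | hne
    · exact hne hM
    · have hinj : Function.Injective g :=
        (Finite.injective_iff_surjective_of_equiv
          ((Equiv.subtypeUnivEquiv (p := (· ∈ M)) (fun v => hM ▸ Set.mem_univ v)))).2 hgs
      apply hne
      ext u v
      simp only [bot_adj, iff_false]
      intro huv
      have hu : u ∈ M := hM ▸ Set.mem_univ u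
      have hv : v ∈ M := hM ▸ Set.mem_univ v
      have hadj : F'.Adj ⟨u, hu⟩ ⟨v, hv⟩ := huv
      have : g ⟨u, hu⟩ = g ⟨v, hv⟩ := by
        simp only [g]; rw [ConnectedComponent.sound hadj.reachable]
      have h2 := congrArg Subtype.val (hinj this)
      exact F.ne_of_adj huv h2
  obtain ⟨C⟩ := hG.2 _ _ hprop
  -- `none` serves outside `M` because `Fin (k - 1)` may be empty.
  refine ⟨fun v => if h : v ∈ M then some (C (F'.connectedComponentMk ⟨v, h⟩)) else none, ?_, ?_, ?_⟩
  · intro v hv; simp [hv]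
  · intro u v huv
    have hu := hFM _ _ huv
    have hv := hFM _ _ huv.symm
    have hadj : F'.Adj ⟨u, hu⟩ ⟨v, hv⟩ := huv
    simp only [hu, hv, dite_true]
    rw [ConnectedComponent.sound hadj.reachable]
  · intro u hu v hv huv hr
    simp only [hu, hv, dite_true, ne_eq, Option.some.injEq]
    refine C.valid ⟨fun h => hr ?_, ⟨u, hu⟩, ⟨v, hv⟩, ?_, rfl, rfl⟩
    · have h' : F'.Reachable ⟨u, hu⟩ ⟨v, hv⟩ := ConnectedComponent.exact h
      exact h'.of_closed (fun w => F.Reachable u w.1) (Reachable.refl _)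
        fun x y hxy hx => hx.trans (Adj.reachable (G := F) hxy)
    · simp only [Subgraph.coe_adj, K, Subgraph.induce_adj]
      exact ⟨hu, hv, huv⟩

theorem IsContractionCritical.exists_contract_coloring [Finite V] {G : SimpleGraph V} {k : ℕ}
    (hG : G.IsContractionCritical k) (F : SimpleGraph V) (hFG : F ≤ G) (hne : F ≠ ⊥) :
    ∃ c : V → Fin (k - 1), (∀ u v, F.Reachable u v → c u = c v) ∧
      ∀ u v, G.Adj u v → ¬ F.Reachable u v → c u ≠ c v := by
  obtain ⟨c, h0, h1, h2⟩ := hG.exists_coloring Set.univ F hFG (fun _ _ _ => trivial) (.inr hne)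
  choose c' hc' using fun v => Option.ne_none_iff_exists'.1 (h0 v trivial)
  refine ⟨c', fun u v h => ?_, fun u v h hr he => ?_⟩
  · have := h.eq_of_adj c h1
    rw [hc', hc'] at this; exact Option.some.inj this
  · refine h2 u trivial v trivial h hr ?_
    rw [hc', hc', he]

/-- Two colourings of the sides of a separation that agree on the common part up to an injective
renaming of colours can be combined. -/
theorem colorable_of_glue {G : SimpleGraph V} {n : ℕ} {M M' : Set V}
    (hadj : ∀ u v, G.Adj u v → (u ∈ M ∧ v ∈ M) ∨ (u ∈ M' ∧ v ∈ M'))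
    (c c' : V → Fin n) (hc : ∀ u ∈ M, ∀ v ∈ M, G.Adj u v → c u ≠ c v)
    (hc' : ∀ u ∈ M', ∀ v ∈ M', G.Adj u v → c' u ≠ c' v)
    (hcc : ∀ u ∈ M ∩ M', ∀ v ∈ M ∩ M', c u = c v ↔ c' u = c' v) : G.Colorable n := by
  classical
  have hf : Function.Injective (fun p : Set.range (fun u : ↥(M ∩ M') => c' u) =>
      c (p.2.choose : ↥(M ∩ M'))) := by
    rintro p q hpq
    have h := (hcc _ p.2.choose.2 _ q.2.choose.2).1 hpq
    have hp := p.2.choose_spec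
    have hq := q.2.choose_spec
    exact Subtype.ext (hp.symm.trans (h.trans hq))
  -- The renaming is injective on the colours of the common part, so finiteness extends it to a
  -- permutation of all colours.
  let σ : Equiv.Perm (Fin n) := (Equiv.ofInjective _ hf).extendSubtype
  have hσ : ∀ u ∈ M ∩ M', σ (c' u) = c u := by
    intro u hu
    have hmem : c' u ∈ Set.range (fun u : ↥(M ∩ M') => c' u) := ⟨⟨u, hu⟩, rfl⟩
    rw [Equiv.extendSubtype_apply_of_mem _ _ hmem]
    exact (hcc _ hmem.choose.2 _ hu).2 hmem.choose_spec
  have hM' : ∀ u ∈ M', (if u ∈ M then c u else σ (c' u)) = σ (c' u) := by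
    intro u hu
    split_ifs with h
    · exact (hσ u ⟨h, hu⟩).symm
    · rfl
  refine ⟨Coloring.mk (fun u => if u ∈ M then c u else σ (c' u)) ?_⟩
  intro u v huv
  rcases hadj u v huv with ⟨hu, hv⟩ | ⟨hu, hv⟩
  · simpa [hu, hv] using hc u hu v hv huv
  · rw [hM' u hu, hM' v hv]
    exact fun h => hc' u hu v hv huv (σ.injective h)

/-! ### Kempe chains and simultaneous swaps -/

/-- `c` is a proper colouring of the subgraph induced by `M`. -/
def IsProperOn (G : SimpleGraph V) (M : Set V) (c : V → α) : Prop :=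
  ∀ u ∈ M, ∀ v ∈ M, G.Adj u v → c u ≠ c v

/-- The vertices of `M` that are coloured `p` or `l`. -/
def twoColored (M : Set V) (c : V → α) (p l : α) : Set V :=
  {v | v ∈ M ∧ (c v = p ∨ c v = l)}

/-- The union of the Kempe chains in the colours `p` and `l` that contain a vertex of `T` coloured
`p`. -/
def kempe (G : SimpleGraph V) (M : Set V) (c : V → α) (T : Set V) (l p : α) : Set V :=
  G.reachSet (twoColored M c p l) {x | x ∈ T ∧ c x = p}

theorem kempe_subset {G : SimpleGraph V} {M T : Set V} (hT : T ⊆ M) (c : V → α) (l p : α) :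
    G.kempe M c T l p ⊆ twoColored M c p l :=
  reachSet_subset fun _ hx => ⟨hT hx.1, .inl hx.2⟩

/-- The classes with colours in `U` are either pairwise separated by the Kempe chains that use `l`,
or two of them can be joined by an edge using vertices of these chains only. -/
theorem exists_chain_parts {G : SimpleGraph V} {M T : Set V} (hT : T ⊆ M) (c : V → α) (U : Finset α)
    (l p₀ : α) (hl : ∀ x ∈ T, c x ≠ l) (hlU : l ∉ U)
    (hconn : ∀ p ∈ U, ∀ x ∈ T, ∀ y ∈ T, c x = p → c y = p →
      (G.onSet (twoColored M c p l)).Reachable x y) :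
    ∃ Q : α → Set V,
      (∀ p, ∀ v ∈ Q p, p ∈ U ∧ v ∈ M ∧ (c v = p ∨ c v = l)) ∧
      (∀ p q v, v ∈ Q p → v ∈ Q q → p = q) ∧
      (∀ p, ∀ v ∈ Q p, ∃ x ∈ T, c x = p ∧ (G.onSet (Q p)).Reachable x v) ∧
      (((∀ p ∈ U, ∀ q ∈ U, p ≠ q → ∀ v ∈ G.kempe M c T l p, ∀ w ∈ G.kempe M c T l q,
            v ≠ w ∧ ¬ G.Adj v w) ∧
          ∀ p ∈ U, ∀ x ∈ T, ∀ y ∈ T, c x = p → c y = p → (G.onSet (Q p)).Reachable x y) ∨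
        ∃ p ∈ U, ∃ q ∈ U, p ≠ q ∧ q ≠ p₀ ∧ (∃ v ∈ Q p, ∃ w ∈ Q q, G.Adj v w) ∧
          ∀ x ∈ T, ∀ y ∈ T, c x = p → c y = p → (G.onSet (Q p)).Reachable x y) := by
  classical
  set K := G.kempe M c T l with hK
  have hKsub : ∀ p, K p ⊆ twoColored M c p l := kempe_subset hT c l
  have hKconn : ∀ p ∈ U, ∀ x ∈ T, ∀ y ∈ T, c x = p → c y = p → (G.onSet (K p)).Reachable x y :=
    fun p hp x hx y hy hxp hyp =>
      reachable_onSet_reachSet (X := {x | x ∈ T ∧ c x = p}) ⟨hx, hxp⟩ (hconn p hp x hx y hy hxp hyp)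
  have hKreach : ∀ p, ∀ v ∈ K p, ∃ x ∈ T, c x = p ∧ (G.onSet (K p)).Reachable x v := by
    rintro p v ⟨x, hx, hr⟩
    exact ⟨x, hx.1, hx.2, reachable_onSet_reachSet hx hr⟩
  by_cases hind : ∀ p ∈ U, ∀ q ∈ U, p ≠ q → ∀ v ∈ K p, ∀ w ∈ K q, v ≠ w ∧ ¬ G.Adj v w
  · refine ⟨fun p => {v | p ∈ U ∧ v ∈ K p}, ?_, ?_, ?_, .inl ⟨hind, ?_⟩⟩
    · rintro p v ⟨hp, hv⟩
      exact ⟨hp, hKsub p hv⟩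
    · rintro p q v ⟨hp, hvp⟩ ⟨hq, hvq⟩
      by_contra hpq
      exact (hind p hp q hq hpq v hvp v hvq).1 rfl
    · rintro p v ⟨hp, hv⟩
      simpa [hp] using hKreach p v hv
    · intro p hp
      simpa [hp] using hKconn p hp
  -- The two chains in contact play different roles: `p` keeps its whole chain, `q` may lose part of
  -- its own. The pair is ordered so that `p₀` is never the loser.
  · have hex : ∃ p ∈ U, ∃ q ∈ U, p ≠ q ∧ q ≠ p₀ ∧ ∃ v ∈ K p, ∃ w ∈ K q, v = w ∨ G.Adj v w := by
      push Not at hind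
      obtain ⟨p, hp, q, hq, hpq, v, hv, w, hw, h⟩ := hind
      have h' : v = w ∨ G.Adj v w := by
        by_cases hvw : v = w
        · exact .inl hvw
        · exact .inr (h hvw)
      by_cases hq0 : q = p₀
      · exact ⟨q, hq, p, hp, hpq.symm, fun h => hpq (h.trans hq0.symm), w, hw, v, hv,
          h'.imp Eq.symm Adj.symm⟩
      · exact ⟨p, hp, q, hq, hpq, hq0, v, hv, w, hw, h'⟩
    obtain ⟨p, hp, q, hq, hpq, hq0, v, hv, w, hw, hvw⟩ := hex
    set N := twoColored M c q l \ K p with hN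
    set Xq : Set V := {x | x ∈ T ∧ c x = q} with hXq
    have hlq : l ≠ q := fun h => hlU (h ▸ hq)
    have hXN : Xq ⊆ N := by
      rintro x ⟨hx, hxq⟩
      refine ⟨⟨hT hx, .inl hxq⟩, fun hxK => ?_⟩
      rcases (hKsub p hxK).2 with h | h
      · exact hpq (h.symm.trans hxq)
      · exact hl x hx h
    set W := G.reachSet N Xq with hW
    have hWN : W ⊆ N := reachSet_subset hXN
    -- If `W` had no neighbour in `K p`, growth from the class of `q` would never enter `K p`. All
    -- of `K q` would then lie in `W`, against the contact between the two chains.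
    have hedge : ∃ v ∈ K p, ∃ w ∈ W, G.Adj v w := by
      by_contra hno
      push Not at hno
      have hsub : K q ⊆ W := by
        rintro z ⟨x, hx, hr⟩
        refine hr.of_closed (· ∈ W) (subset_reachSet _ _ _ hx) ?_
        rintro a b ⟨hab, -, hb⟩ ha
        refine mem_reachSet_of_adj ha (hWN ha) ⟨hb, fun hbK => hno b hbK a ha hab.symm⟩ hab
      rcases hvw with h | h
      · exact (hWN (hsub hw)).2 (h ▸ hv)
      · exact hno v hv w (hsub hw) h
    obtain ⟨v', hv', w', hw', hvw'⟩ := hedge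
    refine ⟨fun r => if r = p then K p else if r = q then W else ∅, ?_, ?_, ?_,
      .inr ⟨p, hp, q, hq, hpq, hq0, ⟨v', by simpa using hv', w', ?_, hvw'⟩, ?_⟩⟩
    · intro r z hz
      dsimp only at hz
      split_ifs at hz with h1 h2
      · subst h1; exact ⟨hp, hKsub _ hz⟩
      · subst h2; exact ⟨hq, (hWN hz).1⟩
      · exact hz.elim
    · intro r r' z hz hz'
      dsimp only at hz hz'
      split_ifs at hz hz' with h1 h2 h3 h4 h5 h6
      · rw [h1, h2]
      · exact ((hWN hz').2 hz).elim
      · exact hz'.elim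
      · exact ((hWN hz).2 hz').elim
      · rw [h4, h6]
      · exact hz'.elim
      all_goals exact hz.elim
    · intro r z hz
      dsimp only at hz ⊢
      split_ifs at hz ⊢ with h1 h2
      · subst h1; exact hKreach _ z hz
      · subst h2
        obtain ⟨x, hx, hr⟩ := hz
        exact ⟨x, hx.1, hx.2, reachable_onSet_reachSet hx hr⟩
      · exact hz.elim
    · simpa [hpq.symm] using hw'
    · simpa using hKconn p hp

/-- Simultaneous Kempe changes: on the vertices marked `p` the colours `p` and `e p` are swapped. -/
theorem IsProperOn.swap [DecidableEq α] {G : SimpleGraph V} {M : Set V} {c : V → α}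
    (hc : G.IsProperOn M c) (e : α → α) (φ : V → Option α)
    (h1 : ∀ v ∈ M, ∀ p, φ v = some p → c v = p ∨ c v = e p)
    (h2 : ∀ v ∈ M, ∀ w ∈ M, ∀ p, G.Adj v w → φ v = some p → (c w = p ∨ c w = e p) →
      ∃ q, φ w = some q)
    (h3 : ∀ v ∈ M, ∀ w ∈ M, ∀ p q, G.Adj v w → φ v = some p → φ w = some q → p ≠ q →
      p ≠ e q ∧ e p ≠ q ∧ e p ≠ e q) :
    G.IsProperOn M fun v => (φ v).elim (c v) fun p => Equiv.swap p (e p) (c v) := by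
  have swap_mem : ∀ p q r : α, r = p ∨ r = q → Equiv.swap p q r = p ∨ Equiv.swap p q r = q := by
    rintro p q r (rfl | rfl) <;> simp
  have key : ∀ v ∈ M, ∀ w ∈ M, ∀ p, G.Adj v w → φ v = some p → φ w = none →
      Equiv.swap p (e p) (c v) ≠ c w := by
    intro v hv w hw p hvw hp hn h
    have := swap_mem _ _ _ (h1 v hv p hp)
    rw [h] at this
    obtain ⟨q, h'⟩ := h2 v hv w hw p hvw hp this
    simp [hn] at h'
  intro v hv w hw hvw
  cases hp : φ v with
  | none =>
    cases hq : φ w with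
    | none => simpa [hp, hq] using hc v hv w hw hvw
    | some q => simpa [hp, hq] using (key w hw v hv q hvw.symm hq hp).symm
  | some p =>
    cases hq : φ w with
    | none => simpa [hp, hq] using key v hv w hw p hvw hp hq
    | some q =>
      simp only [hp, hq, Option.elim]
      by_cases hpq : p = q
      · subst hpq
        exact fun h => hc v hv w hw hvw ((Equiv.swap _ _).injective h)
      · obtain ⟨h4, h5, h6⟩ := h3 v hv w hw p q hvw hp hq hpq
        intro h
        rcases swap_mem _ _ _ (h1 v hv p hp) with h7 | h7 <;>
          rcases swap_mem _ _ _ (h1 w hw q hq) with h8 | h8 <;> rw [h7, h8] at h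
        exacts [hpq h, h4 h, h5 h, h6 h]

/-! ### Colourings with the most colours on `T` -/

/-- `c` colours `M` properly, with `A` in a single colour `a` that does not occur on `T`. -/
structure IsMonoColoring (G : SimpleGraph V) (M : Set V) (A T : Finset V) (c : V → α) (a : α) :
    Prop where
  proper : G.IsProperOn M c
  eq_of_mem : ∀ x ∈ A, c x = a
  ne_of_mem : ∀ x ∈ T, c x ≠ a

/-- If `c` uses as many colours on `T` as possible, then each colour class of `T` lies in a single
Kempe chain for every colour that is not used on `T`. -/
theorem IsMonoColoring.reachable_of_max [DecidableEq α] {G : SimpleGraph V} {M : Set V}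
    {A T : Finset V} {c : V → α} {a : α} (hc : G.IsMonoColoring M A T c a) (hT : (T : Set V) ⊆ M)
    (hmax : ∀ (c' : V → α) (a' : α), G.IsMonoColoring M A T c' a' →
      (T.image c').card ≤ (T.image c).card)
    {l : α} (hl : l ∉ T.image c) (hla : l ≠ a) {x y : V} (hx : x ∈ T) (hy : y ∈ T)
    (hxy : c x = c y) : (G.onSet (twoColored M c (c x) l)).Reachable x y := by
  classical
  -- Swapping `p` and `l` on the chain of `x` alone leaves `y` coloured `p`, so the new colouring
  -- gains `l` on `T` and loses no colour.
  by_contra hr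
  set p := c x with hp
  set N := twoColored M c p l with hN
  have hpl : p ≠ l := fun h => hl (Finset.mem_image.2 ⟨x, hx, h⟩)
  have hxN : x ∈ N := ⟨hT hx, .inl rfl⟩
  have hKN : G.reachSet N {x} ⊆ N := reachSet_subset (by simpa using hxN)
  let φ : V → Option α := fun v => if v ∈ G.reachSet N {x} then some p else none
  have hφ : ∀ v q, φ v = some q → q = p ∧ v ∈ G.reachSet N {x} := by
    intro v q h
    simp only [φ] at h
    split_ifs at h with h'
    exact ⟨(Option.some.inj h).symm, h'⟩
  have hprop := hc.proper.swap (fun _ => l) φ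
    (fun v _ q hq => by
      obtain ⟨rfl, hv⟩ := hφ v q hq
      exact (hKN hv).2)
    (fun v _ w hw q hvw hq hcw => by
      obtain ⟨rfl, hv⟩ := hφ v q hq
      exact ⟨p, if_pos (mem_reachSet_of_adj hv (hKN hv) ⟨hw, hcw⟩ hvw)⟩)
    (fun v _ w _ q r _ hq hr hqr => (hqr ((hφ v q hq).1.trans (hφ w r hr).1.symm)).elim)
  set c' : V → α := fun v => (φ v).elim (c v) fun p => Equiv.swap p l (c v) with hc'
  have hval : ∀ v, c' v = c v ∨ (v ∈ G.reachSet N {x} ∧ (c' v = p ∨ c' v = l)) := by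
    intro v
    by_cases hv : v ∈ G.reachSet N {x}
    · right
      refine ⟨hv, ?_⟩
      simp only [hc', φ, hv, if_true, Option.elim]
      rcases (hKN hv).2 with h | h <;> simp [h]
    · left; simp [hc', φ, hv]
  have hmono : G.IsMonoColoring M A T c' a := by
    refine ⟨hprop, fun z hz => ?_, fun z hz => ?_⟩
    · rcases hval z with h | ⟨hzr, -⟩
      · rw [h, hc.eq_of_mem z hz]
      · have h1 := hc.eq_of_mem z hz
        rcases (hKN hzr).2 with h2 | h2
        · exact (hc.ne_of_mem x hx (by rw [← h1, h2])).elim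
        · exact (hla (h2.symm.trans h1)).elim
    · rcases hval z with h | ⟨-, h | h⟩
      · rw [h]; exact hc.ne_of_mem z hz
      · rw [h]; exact hc.ne_of_mem x hx
      · rw [h]; exact hla
  have hxl : c' x = l := by
    have : x ∈ G.reachSet N {x} := subset_reachSet _ _ _ rfl
    simp [hc', φ, this, ← hp]
  have hyp : c' y = p := by
    have : y ∉ G.reachSet N {x} := by
      rintro ⟨z, rfl, h⟩; exact hr h
    simp [hc', φ, this, ← hxy]
  have hsub : insert l (T.image c) ⊆ T.image c' := by
    intro q hq
    rw [Finset.mem_insert, Finset.mem_image] at hq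
    rw [Finset.mem_image]
    rcases hq with rfl | ⟨z, hz, rfl⟩
    · exact ⟨x, hx, hxl⟩
    · by_cases hzp : c z = p
      · exact ⟨y, hy, hyp.trans hzp.symm⟩
      · refine ⟨z, hz, ?_⟩
        rcases hval z with h | ⟨hzr, -⟩
        · exact h
        · rcases (hKN hzr).2 with h | h
          · exact (hzp h).elim
          · exact (hl (Finset.mem_image.2 ⟨z, hz, h⟩)).elim
  have h1 := Finset.card_le_card hsub
  rw [Finset.card_insert_of_notMem hl] at h1
  have h2 := hmax c' a hmono
  omega

/-! ### Contractible blocks -/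

/-- The edges of `G` inside `M` whose ends are in the same block of `b`. -/
def blockGraph (G : SimpleGraph V) (M : Set V) (b : V → Option α) : SimpleGraph V where
  Adj u v := G.Adj u v ∧ u ∈ M ∧ v ∈ M ∧ b u = b v
  symm := ⟨fun _ _ h => ⟨h.1.symm, h.2.2.1, h.2.1, h.2.2.2.symm⟩⟩
  loopless := ⟨fun _ h => G.loopless.irrefl _ h.1⟩

theorem Reachable.block_eq {G : SimpleGraph V} {M : Set V} {b : V → Option α} {u v : V}
    (h : (G.blockGraph M b).Reachable u v) : b u = b v :=
  h.eq_of_adj b fun _ _ h => h.2.2.2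

theorem Reachable.mem_of_ne {G : SimpleGraph V} {M : Set V} {b : V → Option α} {u v : V}
    (h : (G.blockGraph M b).Reachable u v) (hne : u ≠ v) : v ∈ M :=
  (h.of_closed (fun w => w = u ∨ w ∈ M) (.inl rfl) fun _ _ h _ => .inr h.2.2.1).resolve_left hne.symm

/-- Disjoint connected blocks containing the colour classes of `T`, such that every set `U` of
colours in `𝓤` either has pairwise separated Kempe chains in the label `ℓ U`, or contains two colours
whose blocks are adjacent. -/
theorem exists_blocks [DecidableEq α] {G : SimpleGraph V} {M : Set V}
    {T : Finset V} {c : V → α} {a : α} (hT : (T : Set V) ⊆ M) (𝓤 : Finset (Finset α))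
    (ℓ : Finset α → α) (p₀ : α) (hsub : ∀ U ∈ 𝓤, U ⊆ T.image c)
    (htwo : ∀ U, U ⊆ T.image c → 2 ≤ U.card → U ∈ 𝓤) (hinj : Set.InjOn ℓ 𝓤)
    (hℓ : ∀ U ∈ 𝓤, ℓ U ∉ T.image c) (hℓa : ∀ U ∈ 𝓤, ℓ U ≠ a)
    (hfull : ∀ x ∈ T, ∀ y ∈ T, x ≠ y → c x = c y →
      {c x} ∈ 𝓤 ∨ (c x = p₀ ∧ ∃ q ∈ T.image c, q ≠ c x))
    (hconn : ∀ l ∉ T.image c, l ≠ a → ∀ x ∈ T, ∀ y ∈ T, c x = c y →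
      (G.onSet (twoColored M c (c x) l)).Reachable x y) :
    ∃ b : V → Option α,
      (∀ v p, b v = some p → v ∈ M ∧ p ∈ T.image c ∧ (c v = p ∨ ∃ U ∈ 𝓤, p ∈ U ∧ c v = ℓ U)) ∧
      (∀ x ∈ T, b x = some (c x)) ∧
      (∀ v w p, b v = some p → b w = some p → (G.blockGraph M b).Reachable v w) ∧
      ∀ U ∈ 𝓤,
        (∀ p ∈ U, ∀ q ∈ U, p ≠ q → ∀ v ∈ G.kempe M c T (ℓ U) p, ∀ w ∈ G.kempe M c T (ℓ U) q,
          ¬ G.Adj v w) ∨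
        ∃ p ∈ U, ∃ q ∈ U, p ≠ q ∧ ∃ v w, b v = some p ∧ b w = some q ∧ G.Adj v w := by
  classical
  have hparts : ∀ U ∈ 𝓤, _ := fun U hU =>
    exists_chain_parts (G := G) hT c U (ℓ U) p₀
      (fun x hx h => hℓ U hU (Finset.mem_image.2 ⟨x, hx, h⟩)) (fun h => hℓ U hU (hsub U hU h))
      (fun p _ x hx y hy hxp hyp => by
        subst hxp
        exact hconn _ (hℓ U hU) (hℓa U hU) x hx y hy hyp.symm)
  choose! Q hQ1 hQ2 hQ3 hQ4 using hparts
  let B : α → Set V := fun p => {v | (v ∈ T ∧ c v = p) ∨ ∃ U ∈ 𝓤, v ∈ Q U p}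
  have hP : ∀ x ∈ T, c x ∈ T.image c := fun x hx => Finset.mem_image_of_mem c hx
  -- A vertex of a piece has either the colour of its own class or a label. Labels are distinct and
  -- lie outside `T.image c`, so a label determines `U`, within which the pieces are disjoint.
  have hBuniq : ∀ p q v, v ∈ B p → v ∈ B q → p = q := by
    have aux : ∀ p q v, (v ∈ T ∧ c v = p) → (∃ U ∈ 𝓤, v ∈ Q U q) → p = q := by
      rintro p q v ⟨hv, rfl⟩ ⟨U, hU, hvQ⟩
      rcases (hQ1 U hU q v hvQ).2.2 with h | h
      · exact h
      · exact (hℓ U hU (h ▸ hP v hv)).elim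
    rintro p q v (h1 | h1) (h2 | h2)
    · exact h1.2.symm.trans h2.2
    · exact aux p q v h1 h2
    · exact (aux q p v h2 h1).symm
    · obtain ⟨U, hU, hv⟩ := h1
      obtain ⟨U', hU', hv'⟩ := h2
      obtain ⟨hp, -, h⟩ := hQ1 U hU p v hv
      obtain ⟨hq, -, h'⟩ := hQ1 U' hU' q v hv'
      rcases h with h | h <;> rcases h' with h' | h' <;> rw [h] at h'
      · exact h'
      · exact (hℓ U' hU' (h' ▸ hsub U hU hp)).elim
      · exact (hℓ U hU (h' ▸ hsub U' hU' hq)).elim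
      · obtain rfl := hinj hU hU' h'
        exact hQ2 U hU p q v hv hv'
  let b : V → Option α := fun v => if h : ∃ p, v ∈ B p then some h.choose else none
  have hb : ∀ v p, b v = some p ↔ v ∈ B p := by
    intro v p
    simp only [b]
    split_ifs with h
    · rw [Option.some.injEq]
      exact ⟨fun h' => h' ▸ h.choose_spec, fun h' => hBuniq _ _ v h.choose_spec h'⟩
    · simp only [false_iff]
      exact fun h' => h ⟨p, h'⟩
  have hBM : ∀ p v, v ∈ B p → v ∈ M := by
    rintro p v (⟨hv, -⟩ | ⟨U, hU, hv⟩)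
    · exact hT hv
    · exact (hQ1 U hU p v hv).2.1
  have hle : ∀ U ∈ 𝓤, ∀ p, G.onSet (Q U p) ≤ G.blockGraph M b := by
    rintro U hU p v w ⟨h, hv, hw⟩
    have hv' : v ∈ B p := .inr ⟨U, hU, hv⟩
    have hw' : w ∈ B p := .inr ⟨U, hU, hw⟩
    exact ⟨h, hBM _ _ hv', hBM _ _ hw', ((hb v p).2 hv').trans ((hb w p).2 hw').symm⟩
  have hTT : ∀ x ∈ T, ∀ y ∈ T, c x = c y → (G.blockGraph M b).Reachable x y := by
    intro x hx y hy hxy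
    by_cases hne : x = y
    · exact hne ▸ Reachable.refl _
    suffices h : ∃ U ∈ 𝓤, (G.onSet (Q U (c x))).Reachable x y by
      obtain ⟨U, hU, h⟩ := h
      exact h.mono (hle U hU _)
    rcases hfull x hx y hy hne hxy with h | ⟨hp, q, hq, hqp⟩
    · refine ⟨_, h, ?_⟩
      rcases hQ4 _ h with h4 | ⟨r, hr, s, hs, hrs, -⟩
      · exact h4.2 _ (Finset.mem_singleton_self _) x hx y hy rfl hxy.symm
      · rw [Finset.mem_singleton] at hr hs
        exact (hrs (hr.trans hs.symm)).elim
    -- With no singleton available, the class `p₀` is connected through a pair. In that pair `p₀` is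
    -- either separated from `q` or the member that keeps its whole chain.
    · have hU : ({c x, q} : Finset α) ∈ 𝓤 := by
        refine htwo _ ?_ (Finset.card_pair hqp.symm).ge
        intro r hr
        rw [Finset.mem_insert, Finset.mem_singleton] at hr
        rcases hr with rfl | rfl
        exacts [hP x hx, hq]
      refine ⟨_, hU, ?_⟩
      rcases hQ4 _ hU with h4 | ⟨r, hr, s, hs, hrs, hs0, -, h4⟩
      · exact h4.2 _ (Finset.mem_insert_self _ _) x hx y hy rfl hxy.symm
      · rw [Finset.mem_insert, Finset.mem_singleton] at hr hs
        have hs' : s = q := hs.resolve_left fun h => hs0 (h.trans hp)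
        have hr' : r = c x := hr.resolve_right fun h => hrs (h.trans hs'.symm)
        subst hr'
        exact h4 x hx y hy rfl hxy.symm
  have hreach : ∀ p v, v ∈ B p → ∃ x ∈ T, c x = p ∧ (G.blockGraph M b).Reachable x v := by
    rintro p v (⟨hv, h⟩ | ⟨U, hU, hv⟩)
    · exact ⟨v, hv, h, Reachable.refl _⟩
    · obtain ⟨x, hx, hxp, hr⟩ := hQ3 U hU p v hv
      exact ⟨x, hx, hxp, hr.mono (hle U hU p)⟩
  refine ⟨b, ?_, fun x hx => (hb x _).2 (.inl ⟨hx, rfl⟩), ?_, ?_⟩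
  · intro v p hv
    rw [hb] at hv
    refine ⟨hBM p v hv, ?_⟩
    rcases hv with ⟨hv, rfl⟩ | ⟨U, hU, hv⟩
    · exact ⟨hP v hv, .inl rfl⟩
    · obtain ⟨hp, -, h⟩ := hQ1 U hU p v hv
      exact ⟨hsub U hU hp, h.imp_right fun h => ⟨U, hU, hp, h⟩⟩
  · intro v w p hv hw
    obtain ⟨x, hx, hxp, hxv⟩ := hreach p v ((hb v p).1 hv)
    obtain ⟨y, hy, hyp, hyw⟩ := hreach p w ((hb w p).1 hw)
    exact hxv.symm.trans ((hTT x hx y hy (hxp.trans hyp.symm)).trans hyw)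
  · intro U hU
    rcases hQ4 U hU with h | ⟨p, hp, q, hq, hpq, -, ⟨v, hv, w, hw, hvw⟩, -⟩
    · exact .inl fun p hp q hq hpq v hv w hw => (h.1 p hp q hq hpq v hv w hw).2
    · exact .inr ⟨p, hp, q, hq, hpq, v, w, (hb v p).2 (.inr ⟨U, hU, hv⟩),
        (hb w q).2 (.inr ⟨U, hU, hw⟩), hvw⟩

/-! ### Transfer of the colouring of the minor -/

/-- A colouring `c'` of `G` that is constant on the blocks, and otherwise proper on `M`, can be
transferred to a proper colouring of `M` inducing the same partition of `A ∪ T`. -/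
theorem IsMonoColoring.exists_transfer [DecidableEq α] [Nonempty α] {G : SimpleGraph V} {M : Set V}
    {A T : Finset V} {c : V → α} {a : α} (hc : G.IsMonoColoring M A T c a) (hT : (T : Set V) ⊆ M)
    (𝓤 : Finset (Finset α)) (ℓ : Finset α → α)
    (htwo : ∀ U, U ⊆ T.image c → 2 ≤ U.card → U ∈ 𝓤) (hinj : Set.InjOn ℓ 𝓤)
    (hℓ : ∀ U ∈ 𝓤, ℓ U ∉ T.image c) (hℓa : ∀ U ∈ 𝓤, ℓ U ≠ a)
    (b : V → Option α)
    (hb1 : ∀ v p, b v = some p →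
      v ∈ M ∧ p ∈ T.image c ∧ (c v = p ∨ ∃ U ∈ 𝓤, p ∈ U ∧ c v = ℓ U))
    (hb2 : ∀ x ∈ T, b x = some (c x))
    (hb4 : ∀ U ∈ 𝓤,
        (∀ p ∈ U, ∀ q ∈ U, p ≠ q → ∀ v ∈ G.kempe M c T (ℓ U) p, ∀ w ∈ G.kempe M c T (ℓ U) q,
          ¬ G.Adj v w) ∨
        ∃ p ∈ U, ∃ q ∈ U, p ≠ q ∧ ∃ v w, b v = some p ∧ b w = some q ∧ G.Adj v w)
    (H : Finset α) (hH : A.card ≤ H.card) (hHP : ∀ p ∈ H, p ∉ T.image c)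
    (hHℓ : ∀ U ∈ 𝓤, ℓ U ∉ H) {β : Type*} [Nonempty β] (c' : V → β)
    (hc'b : ∀ v w p, b v = some p → b w = some p → c' v = c' w)
    (hc'adj : ∀ v ∈ M, ∀ w ∈ M, G.Adj v w → b v = none → b w = none → c' v = c' w)
    (hc'ne : ∀ v ∈ M, ∀ w ∈ M, G.Adj v w → b v ≠ b w → c' v ≠ c' w) :
    ∃ c'' : V → α, G.IsProperOn M c'' ∧
      ∀ u, u ∈ A ∨ u ∈ T → ∀ v, v ∈ A ∨ v ∈ T → (c'' u = c'' v ↔ c' u = c' v) := by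
  classical
  set P := T.image c with hPdef
  have hP : ∀ x ∈ T, c x ∈ P := fun x hx => Finset.mem_image_of_mem c hx
  have haP : a ∉ P := by
    intro h
    obtain ⟨x, hx, h⟩ := Finset.mem_image.1 h
    exact hc.ne_of_mem x hx h
  have hrep : ∀ p : α, ∃ γ : β, ∀ v, b v = some p → c' v = γ := by
    intro p
    by_cases h : ∃ v, b v = some p
    · obtain ⟨v, hv⟩ := h
      exact ⟨c' v, fun w hw => hc'b w v p hw hv⟩
    · push Not at h
      exact ⟨Classical.arbitrary β, fun v hv => (h v hv).elim⟩
  choose d hd using hrep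
  -- `d p` is the colour that `c'` gives to block `p`, and `grp p` collects the classes to be merged
  -- with `p`. Their common new colour `e p` is the label of the group; a group of one keeps its
  -- colour.
  let grp : α → Finset α := fun p => P.filter fun q => d q = d p
  let e : α → α := fun p => if 2 ≤ (grp p).card then ℓ (grp p) else p
  have hgrp : ∀ p, 2 ≤ (grp p).card → grp p ∈ 𝓤 := fun p h => htwo _ (Finset.filter_subset _ _) h
  have hself : ∀ p ∈ P, p ∈ grp p := fun p hp => Finset.mem_filter.2 ⟨hp, rfl⟩
  have he : ∀ p, 2 ≤ (grp p).card → e p = ℓ (grp p) := fun p h => if_pos h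
  have heP : ∀ p, 2 ≤ (grp p).card → e p ∉ P := fun p h => by rw [he p h]; exact hℓ _ (hgrp p h)
  -- Two adjacent blocks in one group would receive different colours from `c'`, so the group falls
  -- under the separated alternative.
  have hinde : ∀ p, 2 ≤ (grp p).card → ∀ r ∈ grp p, ∀ s ∈ grp p, r ≠ s →
      ∀ v ∈ G.kempe M c T (e p) r, ∀ w ∈ G.kempe M c T (e p) s, ¬ G.Adj v w := by
    intro p hp
    rw [he p hp]
    refine (hb4 _ (hgrp p hp)).resolve_right ?_
    rintro ⟨r, hr, s, hs, hrs, v, w, hv, hw, hvw⟩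
    refine hc'ne v (hb1 v r hv).1 w (hb1 w s hw).1 hvw ?_ ?_
    · rw [hv, hw]; simpa using hrs
    · rw [hd r v hv, hd s w hw, (Finset.mem_filter.1 hr).2, (Finset.mem_filter.1 hs).2]
  have hgrpeq : ∀ p q, d p = d q → grp p = grp q := by
    intro p q h
    simp only [grp, h]
  have heinj : ∀ p ∈ P, ∀ q ∈ P, e p = e q → d p = d q := by
    intro p hp q hq h
    by_cases h1 : 2 ≤ (grp p).card <;> by_cases h2 : 2 ≤ (grp q).card
    · rw [he p h1, he q h2] at h
      have h3 := hinj (hgrp p h1) (hgrp q h2) h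
      have h4 : p ∈ grp q := h3 ▸ hself p hp
      exact (Finset.mem_filter.1 h4).2
    · refine (heP p h1 ?_).elim
      rw [h]; simpa [e, h2] using hq
    · refine (heP q h2 ?_).elim
      rw [← h]; simpa [e, h1] using hp
    · simp only [e, h1, h2, if_false] at h
      rw [h]
  let φ : V → Option α := fun v =>
    if h : ∃ p ∈ P, 2 ≤ (grp p).card ∧ v ∈ G.kempe M c T (e p) p then some h.choose else none
  have hφ : ∀ v p, φ v = some p → p ∈ P ∧ 2 ≤ (grp p).card ∧ v ∈ G.kempe M c T (e p) p := by
    intro v p h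
    simp only [φ] at h
    split_ifs at h with h'
    have := h'.choose_spec
    rwa [Option.some.inj h] at this
  have hφ' : ∀ v, ∀ p ∈ P, 2 ≤ (grp p).card → v ∈ G.kempe M c T (e p) p → ∃ q, φ v = some q := by
    intro v p hp h hv
    have h' : ∃ p ∈ P, 2 ≤ (grp p).card ∧ v ∈ G.kempe M c T (e p) p := ⟨p, hp, h, hv⟩
    exact ⟨_, dif_pos h'⟩
  have hφc : ∀ v p, φ v = some p → c v = p ∨ c v = e p := fun v p h =>
    (kempe_subset hT c (e p) p (hφ v p h).2.2).2
  have hprop := hc.proper.swap e φ (fun v _ p h => hφc v p h)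
    (fun v hv w hw p hvw h hcw => by
      obtain ⟨h1, h2, h3⟩ := hφ v p h
      exact hφ' w p h1 h2 (mem_reachSet_of_adj h3 ⟨hv, hφc v p h⟩ ⟨hw, hcw⟩ hvw))
    (fun v _ w _ p q hvw h h' hpq => by
      obtain ⟨h1, h2, h3⟩ := hφ v p h
      obtain ⟨h4, h5, h6⟩ := hφ w q h'
      refine ⟨fun h => heP q h5 (h ▸ h1), fun h => heP p h2 (h ▸ h4), fun h => ?_⟩
      have h7 := hgrpeq p q (heinj p h1 q h4 h)
      exact hinde p h2 p (hself p h1) q (h7 ▸ hself q h4) hpq v h3 w (h ▸ h6) hvw)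
  set c₁ : V → α := fun v => (φ v).elim (c v) fun p => Equiv.swap p (e p) (c v) with hc₁
  have hval : ∀ v, (φ v = none ∧ c₁ v = c v) ∨
      ∃ p, φ v = some p ∧ ((c v = p ∧ c₁ v = e p) ∨ (c v = e p ∧ c₁ v = p)) := by
    intro v
    cases h : φ v with
    | none => exact .inl ⟨rfl, by simp [hc₁, h]⟩
    | some p =>
      refine .inr ⟨p, rfl, ?_⟩
      rcases hφc v p h with h' | h' <;> simp [hc₁, h, h']
  have hc₁T : ∀ x ∈ T, c₁ x = e (c x) := by
    intro x hx
    rcases hval x with ⟨h, h'⟩ | ⟨p, h, ⟨h1, h2⟩ | ⟨h1, h2⟩⟩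
    · have : ¬ 2 ≤ (grp (c x)).card := by
        intro h2
        obtain ⟨q, hq⟩ := hφ' x (c x) (hP x hx) h2 (subset_reachSet _ _ _ ⟨hx, rfl⟩)
        simp [h] at hq
      rw [h']; simp [e, this]
    · rw [h2, h1]
    · exact (heP p (hφ x p h).2.1 (h1 ▸ hP x hx)).elim
  have hea : ∀ p, 2 ≤ (grp p).card → e p ≠ a := fun p h => by rw [he p h]; exact hℓa _ (hgrp p h)
  have hc₁A : ∀ x ∈ A, c₁ x = a := by
    intro x hx
    have hxa := hc.eq_of_mem x hx
    rcases hval x with ⟨-, h'⟩ | ⟨p, h, ⟨h1, -⟩ | ⟨h1, -⟩⟩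
    · rw [h', hxa]
    · exact (haP (hxa ▸ h1 ▸ (hφ x p h).1)).elim
    · exact (hea p (hφ x p h).2.1 (h1.symm.trans hxa)).elim
  have hAb : ∀ x ∈ A, b x = none := by
    intro x hx
    have hxa := hc.eq_of_mem x hx
    cases h : b x with
    | none => rfl
    | some p =>
      obtain ⟨-, hp, h1 | ⟨U, hU, -, h1⟩⟩ := hb1 x p h
      · exact (haP (hxa ▸ h1 ▸ hp)).elim
      · exact (hℓa U hU (h1.symm.trans hxa)).elim
  -- After the swaps, a vertex of block `q` can carry the colour of a group only if `q` belongs to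
  -- that group. This protects the blocks when `A` is recoloured.
  have hblock : ∀ v q, b v = some q → (c₁ v ∈ P ∨ ∃ U ∈ 𝓤, c₁ v = ℓ U) ∧
      ∀ p ∈ P, c₁ v = e p → d q = d p := by
    intro v q hv
    obtain ⟨-, hq, hcv⟩ := hb1 v q hv
    rcases hval v with ⟨h, h'⟩ | ⟨r, h, ⟨h1, h2⟩ | ⟨h1, h2⟩⟩
    · rw [h']
      refine ⟨hcv.imp (fun h : c v = q => h ▸ hq) fun ⟨U, hU, _, h⟩ => ⟨U, hU, h⟩, fun p hp hpe => ?_⟩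
      rcases hcv with hcv | ⟨U, hU, hqU, hcv⟩
      · by_cases h2 : 2 ≤ (grp p).card
        · exact (heP p h2 (hpe ▸ hcv ▸ hq)).elim
        · simp only [e, h2, if_false] at hpe
          rw [← hcv, hpe]
      · by_cases h2 : 2 ≤ (grp p).card
        · rw [he p h2, hcv] at hpe
          rw [hinj hU (hgrp p h2) hpe] at hqU
          exact (Finset.mem_filter.1 hqU).2
        · simp only [e, h2, if_false] at hpe
          exact (hℓ U hU (hcv ▸ hpe ▸ hp)).elim
    · obtain ⟨hr, hr2, -⟩ := hφ v r h
      refine ⟨.inr ⟨_, hgrp r hr2, by rw [h2, he r hr2]⟩, fun p hp hpe => ?_⟩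
      have hqr : q = r := by
        rcases hcv with hcv | ⟨U, hU, -, hcv⟩
        · exact hcv.symm.trans h1
        · exact (hℓ U hU (hcv ▸ h1 ▸ hr)).elim
      rw [hqr]
      exact heinj r hr p hp (h2.symm.trans hpe)
    · obtain ⟨hr, hr2, -⟩ := hφ v r h
      rw [h2]
      refine ⟨.inl hr, fun p hp hpe => ?_⟩
      by_cases h3 : 2 ≤ (grp p).card
      · exact (heP p h3 (hpe ▸ hr)).elim
      · simp only [e, h3, if_false] at hpe
        exact (h3 (hpe ▸ hr2)).elim
  have hblocka : ∀ v q, b v = some q → c₁ v ≠ a := by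
    intro v q hv hva
    rcases (hblock v q hv).1 with h | ⟨U, hU, h⟩
    · exact haP (hva ▸ h)
    · exact hℓa U hU (h.symm.trans hva)
  obtain ⟨g, hgH, hginj⟩ : ∃ g : β → α, (∀ γ ∈ A.image c', g γ ∈ H) ∧
      Set.InjOn g (A.image c' : Finset β) := by
    have hcard : ((A.image c' : Finset β) : Set β).encard ≤ (H : Set α).encard := by
      rw [Set.encard_coe_eq_coe_finsetCard, Set.encard_coe_eq_coe_finsetCard]
      exact_mod_cast Finset.card_image_le.trans hH
    obtain ⟨g, h1, h2⟩ := (Finset.finite_toSet (A.image c')).exists_injOn_of_encard_le hcard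
    exact ⟨g, fun γ hγ => h1 (Finset.mem_coe.2 hγ), h2⟩
  -- `f` translates colours of `c'`: to the colour of the matching group, else to a private colour
  -- from `H` if the colour occurs on `A`, else to `a`, in which case the swap below does nothing.
  let f : β → α := fun γ =>
    if h : ∃ p ∈ P, d p = γ then e h.choose else if γ ∈ A.image c' then g γ else a
  have hf : ∀ γ, (∃ p ∈ P, d p = γ ∧ f γ = e p) ∨
      ((∀ p ∈ P, d p ≠ γ) ∧ γ ∈ A.image c' ∧ f γ = g γ) ∨ (γ ∉ A.image c' ∧ f γ = a) := by
    intro γ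
    by_cases h : ∃ p ∈ P, d p = γ
    · exact .inl ⟨h.choose, h.choose_spec.1, h.choose_spec.2, dif_pos h⟩
    · by_cases h' : γ ∈ A.image c'
      · refine .inr (.inl ⟨fun p hp hpγ => h ⟨p, hp, hpγ⟩, h', ?_⟩)
        simp only [f, dif_neg h, if_pos h']
      · refine .inr (.inr ⟨h', ?_⟩)
        simp only [f, dif_neg h, if_neg h']
  have heH : ∀ p ∈ P, e p ∉ H := by
    intro p hp h
    by_cases h2 : 2 ≤ (grp p).card
    · rw [he p h2] at h; exact hHℓ _ (hgrp p h2) h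
    · simp only [e, h2, if_false] at h
      exact hHP p h hp
  have hfe : ∀ x ∈ T, f (c' x) = e (c x) := by
    intro x hx
    have hdx : c' x = d (c x) := hd _ x (hb2 x hx)
    by_cases h : ∃ p ∈ P, d p = c' x
    · have h1 : f (c' x) = e h.choose := dif_pos h
      have h2 : d h.choose = d (c x) := h.choose_spec.2.trans hdx
      have h3 := hgrpeq _ _ h2
      rw [h1]
      by_cases h4 : 2 ≤ (grp (c x)).card
      · rw [he _ h4, he _ (h3 ▸ h4), h3]
      · have h5 : h.choose ∈ grp (c x) := Finset.mem_filter.2 ⟨h.choose_spec.1, h2⟩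
        rw [Finset.card_le_one.1 (by omega : (grp (c x)).card ≤ 1) _ h5 _ (hself _ (hP x hx))]
    · exact (h ⟨c x, hP x hx, hdx.symm⟩).elim
  -- Outside the blocks `c'` is constant along the edges inside `M`, so each component there
  -- undergoes a single permutation and stays proper. It sends `a`, the colour of `A`, to the
  -- required one.
  let c₂ : V → α := fun v => if b v = none then Equiv.swap a (f (c' v)) (c₁ v) else c₁ v
  have hmix : ∀ v ∈ M, ∀ w ∈ M, G.Adj v w → b v = none → ∀ q, b w = some q → c₂ v ≠ c₂ w := by
    intro v hv w hw hvw hbv q hbw heq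
    have hne : c' v ≠ c' w := hc'ne v hv w hw hvw (by simp [hbv, hbw])
    simp only [c₂, hbv, hbw, if_true, reduceCtorEq, if_false] at heq
    have h1 := hprop v hv w hw hvw
    have h2 := hblocka w q hbw
    have h3 : c₁ w = f (c' v) := by
      rw [Equiv.swap_apply_def] at heq
      split_ifs at heq with h4 h5
      · exact heq.symm
      · exact (h2 heq.symm).elim
      · exact (h1 heq).elim
    rcases hf (c' v) with ⟨p, hp, hdp, hfp⟩ | ⟨-, hA, hfg⟩ | ⟨-, hfa⟩
    · have := (hblock w q hbw).2 p hp (h3.trans hfp)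
      exact hne (hdp.symm.trans (this.symm.trans (hd q w hbw).symm))
    · have hmem := hgH _ hA
      rw [← hfg, ← h3] at hmem
      rcases (hblock w q hbw).1 with h | ⟨U, hU, h⟩
      · exact hHP _ hmem h
      · exact hHℓ U hU (h ▸ hmem)
    · exact h2 (h3.trans hfa)
  have hS : ∀ u, u ∈ A ∨ u ∈ T → c₂ u = f (c' u) := by
    rintro u (hu | hu)
    · simp [c₂, hAb u hu, hc₁A u hu]
    · simp [c₂, hb2 u hu, hc₁T u hu, hfe u hu]
  refine ⟨c₂, ?_, ?_⟩
  · intro v hv w hw hvw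
    cases hbv : b v with
    | none =>
      cases hbw : b w with
      | none =>
        have h1 := hc'adj v hv w hw hvw hbv hbw
        simp only [c₂, hbv, hbw, if_true, h1]
        exact fun h => hprop v hv w hw hvw ((Equiv.swap _ _).injective h)
      | some q => exact hmix v hv w hw hvw hbv q hbw
    | some p =>
      cases hbw : b w with
      | none => exact (hmix w hw v hv hvw.symm hbw p hbv).symm
      | some q => simpa [c₂, hbv, hbw] using hprop v hv w hw hvw
  · intro u hu v hv
    rw [hS u hu, hS v hv]
    refine ⟨fun h => ?_, fun h => by rw [h]⟩
    have hfS : ∀ u, u ∈ A ∨ u ∈ T → (∃ p ∈ P, d p = c' u ∧ f (c' u) = e p) ∨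
        (c' u ∈ A.image c' ∧ f (c' u) = g (c' u)) := by
      intro u hu
      rcases hf (c' u) with h | h | ⟨h, -⟩
      · exact .inl h
      · exact .inr h.2
      · rcases hu with hu | hu
        · exact (h (Finset.mem_image_of_mem c' hu)).elim
        · refine .inl ⟨c u, hP u hu, (hd _ u (hb2 u hu)).symm, hfe u hu⟩
    rcases hfS u hu with ⟨p, hp, h1, h2⟩ | ⟨h1, h2⟩ <;>
      rcases hfS v hv with ⟨q, hq, h3, h4⟩ | ⟨h3, h4⟩ <;> rw [h2, h4] at h
    · rw [← h1, ← h3]; exact heinj p hp q hq h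
    · exact (heH p hp (h ▸ hgH _ h3)).elim
    · exact (heH q hq (h ▸ hgH _ h1)).elim
    · exact hginj (Finset.mem_coe.2 h1) (Finset.mem_coe.2 h3) h

/-! ### Counting the colours -/

/-- A family of sets of colours on `T` that contains all sets with at least two elements and serves
each colour class with at least two vertices, and is small enough to be labelled by unused colours. -/
theorem exists_label_family [DecidableEq V] [DecidableEq α] (T : Finset V) (c : V → α)
    {m n t : ℕ} (ht : 3 ≤ t) (hTt : T.card ≤ t) (hn : m + T.card + 2 ^ (t - 1) ≤ n + 1 + t)
    {x₀ y₀ : V} (hx₀ : x₀ ∈ T) (hy₀ : y₀ ∈ T) (hne₀ : x₀ ≠ y₀) (hc₀ : c x₀ = c y₀) :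
    ∃ 𝓤 : Finset (Finset α), (∀ U ∈ 𝓤, U ⊆ T.image c) ∧
      (∀ U, U ⊆ T.image c → 2 ≤ U.card → U ∈ 𝓤) ∧
      (∀ x ∈ T, ∀ y ∈ T, x ≠ y → c x = c y →
        {c x} ∈ 𝓤 ∨ (c x = c x₀ ∧ ∃ q ∈ T.image c, q ≠ c x)) ∧
      (T.image c).card + 𝓤.card + m ≤ n := by
  set P := T.image c with hP
  have himg : ∀ x ∈ T, ∀ y ∈ T, x ≠ y → c x = c y → P ⊆ (T.erase x).image c := by
    intro x hx y hy hxy hcxy p hp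
    obtain ⟨z, hz, rfl⟩ := Finset.mem_image.1 hp
    by_cases hzx : z = x
    · exact Finset.mem_image.2 ⟨y, Finset.mem_erase.2 ⟨hxy.symm, hy⟩, by rw [hzx, hcxy]⟩
    · exact Finset.mem_image_of_mem c (Finset.mem_erase.2 ⟨hzx, hz⟩)
  have hlt : P.card + 1 ≤ T.card := by
    have h1 := (Finset.card_le_card (himg x₀ hx₀ y₀ hy₀ hne₀ hc₀)).trans Finset.card_image_le
    rw [Finset.card_erase_of_mem hx₀] at h1
    have := Finset.card_pos.2 ⟨x₀, hx₀⟩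
    omega
  have hpos : 1 ≤ P.card := Finset.card_pos.2 ⟨c x₀, Finset.mem_image_of_mem c hx₀⟩
  have ht2 : t < 2 ^ (t - 1) := by
    obtain ⟨r, rfl⟩ := Nat.exists_eq_add_of_le ht
    have : r < 2 ^ r := Nat.lt_two_pow_self
    rw [show 3 + r - 1 = r + 2 by omega, pow_add]
    omega
  -- With `|P| ≤ |T| - 2` or `|P| = 1`, there is room to label every nonempty set of colours. The
  -- case `|P| = 1`, `|T| = 2` needs `t + 1 ≤ 2 ^ (t - 1)`, hence `t ≥ 3`.
  by_cases hcase : P.card + 2 ≤ T.card ∨ P.card = 1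
  · refine ⟨P.powerset.erase ∅, ?_, ?_, ?_, ?_⟩
    · intro U hU
      exact Finset.mem_powerset.1 (Finset.mem_of_mem_erase hU)
    · intro U hU h2
      refine Finset.mem_erase.2 ⟨?_, Finset.mem_powerset.2 hU⟩
      rintro rfl
      simp at h2
    · intro x hx y hy _ _
      refine .inl (Finset.mem_erase.2 ⟨Finset.singleton_ne_empty _, Finset.mem_powerset.2 ?_⟩)
      exact Finset.singleton_subset_iff.2 (Finset.mem_image_of_mem c hx)
    · rw [Finset.card_erase_of_mem (Finset.mem_powerset.2 (Finset.empty_subset _)),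
        Finset.card_powerset]
      have h1 : 0 < 2 ^ P.card := by positivity
      rcases Nat.lt_or_ge (P.card + 1) T.card with h | h
      · have h3 : 2 ^ P.card ≤ 2 ^ (t - 2) := Nat.pow_le_pow_right (by norm_num) (by omega)
        have h4 : t - 2 < 2 ^ (t - 2) := Nat.lt_two_pow_self
        have h5 : 2 ^ (t - 1) = 2 ^ (t - 2) * 2 := by
          rw [← pow_succ]; congr 1; omega
        omega
      · have hP1 : P.card = 1 := by omega
        rw [hP1] at *
        omega
  -- Now `|P| = |T| - 1`, so a single class has two vertices and the rest have one. Singletons are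
  -- omitted: `P` and the labels then take `2 ^ |P| - 1` colours, which exactly meets the bound when
  -- `|T| = t`.
  · push Not at hcase
    obtain ⟨h1, h2⟩ := hcase
    have hsub : insert ∅ (P.image fun p => ({p} : Finset α)) ⊆ P.powerset := by
      intro U hU
      rw [Finset.mem_insert, Finset.mem_image] at hU
      rw [Finset.mem_powerset]
      rcases hU with rfl | ⟨p, hp, rfl⟩
      · exact Finset.empty_subset _
      · exact Finset.singleton_subset_iff.2 hp
    refine ⟨P.powerset \ insert ∅ (P.image fun p => {p}), ?_, ?_, ?_, ?_⟩
    · intro U hU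
      exact Finset.mem_powerset.1 (Finset.mem_sdiff.1 hU).1
    · intro U hU h3
      refine Finset.mem_sdiff.2 ⟨Finset.mem_powerset.2 hU, ?_⟩
      rw [Finset.mem_insert, Finset.mem_image]
      rintro (rfl | ⟨p, -, rfl⟩) <;> simp at h3
    · intro x hx y hy hxy hcxy
      refine .inr ⟨?_, ?_⟩
      · by_contra hxx
        have hx₀x : x₀ ≠ x := fun h => hxx (by rw [h])
        have hsub2 : P ⊆ ((T.erase x).erase x₀).image c := by
          intro p hp
          obtain ⟨z, hz, rfl⟩ := Finset.mem_image.1 (himg x hx y hy hxy hcxy hp)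
          by_cases hzx : z = x₀
          · refine Finset.mem_image.2 ⟨y₀, ?_, by rw [hzx, hc₀]⟩
            refine Finset.mem_erase.2 ⟨hne₀.symm, Finset.mem_erase.2 ⟨?_, hy₀⟩⟩
            rintro rfl
            exact hxx hc₀.symm
          · exact Finset.mem_image_of_mem c (Finset.mem_erase.2 ⟨hzx, hz⟩)
        have h3 := (Finset.card_le_card hsub2).trans Finset.card_image_le
        rw [Finset.card_erase_of_mem (Finset.mem_erase.2 ⟨hx₀x, hx₀⟩),
          Finset.card_erase_of_mem hx] at h3
        omega
      · have h3 : 1 < P.card := by omega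
        exact Finset.exists_mem_ne h3 (c x)
    · rw [Finset.card_sdiff_of_subset hsub, Finset.card_powerset, Finset.card_insert_of_notMem,
        Finset.card_image_of_injective _ Finset.singleton_injective]
      · have h3 : P.card < 2 ^ P.card := Nat.lt_two_pow_self
        obtain ⟨e, he⟩ := Nat.exists_eq_add_of_le hTt
        have h4 : 2 ^ (t - 1) = 2 ^ P.card * 2 ^ e := by
          rw [← pow_add]; congr 1; omega
        have h5 : e + 1 ≤ 2 ^ e := Nat.lt_two_pow_self
        have h6 : 2 ^ P.card + e ≤ 2 ^ P.card * 2 ^ e := by nlinarith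
        omega
      · rw [Finset.mem_image]
        rintro ⟨p, -, h⟩
        exact Finset.singleton_ne_empty p h

/-- Labels are drawn from outside `P` and `a`, which `1 ≤ m` makes possible. `H` consists of all
colours outside `P` and the labels; it contains `a`. -/
theorem exists_labels [DecidableEq α] [Fintype α] (P : Finset α) {a : α} (ha : a ∉ P)
    (𝓤 : Finset (Finset α)) {m : ℕ} (hm : 1 ≤ m) (hcard : P.card + 𝓤.card + m ≤ Fintype.card α) :
    ∃ (ℓ : Finset α → α) (H : Finset α), Set.InjOn ℓ 𝓤 ∧ (∀ U ∈ 𝓤, ℓ U ∉ P) ∧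
      (∀ U ∈ 𝓤, ℓ U ≠ a) ∧ m ≤ H.card ∧ (∀ p ∈ H, p ∉ P) ∧ ∀ U ∈ 𝓤, ℓ U ∉ H := by
  have h1 : 𝓤.card ≤ (insert a P)ᶜ.card := by
    rw [Finset.card_compl, Finset.card_insert_of_notMem ha]
    omega
  have h2 : (𝓤 : Set (Finset α)).encard ≤ (((insert a P)ᶜ : Finset α) : Set α).encard := by
    rw [Set.encard_coe_eq_coe_finsetCard, Set.encard_coe_eq_coe_finsetCard]
    exact_mod_cast h1
  have : Nonempty α := ⟨a⟩
  obtain ⟨ℓ, hℓ, hinj⟩ := (Finset.finite_toSet 𝓤).exists_injOn_of_encard_le h2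
  have hℓ' : ∀ U ∈ 𝓤, ℓ U ≠ a ∧ ℓ U ∉ P := by
    intro U hU
    have h : ℓ U ∈ (((insert a P)ᶜ : Finset α) : Set α) := hℓ (Finset.mem_coe.2 hU)
    rw [Finset.mem_coe, Finset.mem_compl, Finset.mem_insert] at h
    exact ⟨fun h' => h (.inl h'), fun h' => h (.inr h')⟩
  refine ⟨ℓ, (P ∪ 𝓤.image ℓ)ᶜ, hinj, fun U hU => (hℓ' U hU).2, fun U hU => (hℓ' U hU).1, ?_, ?_, ?_⟩
  · rw [Finset.card_compl]
    have h3 := Finset.card_union_le P (𝓤.image ℓ)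
    have h4 : (𝓤.image ℓ).card ≤ 𝓤.card := Finset.card_image_le
    omega
  · intro p hp hpP
    exact Finset.mem_compl.1 hp (Finset.mem_union_left _ hpP)
  · intro U hU h
    exact Finset.mem_compl.1 h (Finset.mem_union_right _ (Finset.mem_image_of_mem _ hU))

/-! ### Colouring the whole graph across a separation -/

/-- If a colouring of one side that uses as many colours on `T` as possible is not injective on `T`,
then it can be turned into a colouring of the whole graph. -/
theorem IsContractionCritical.colorable_of_max [Finite V] {G : SimpleGraph V}
    {k t : ℕ} (hG : G.IsContractionCritical k) {M M' : Set V} {A T : Finset V}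
    (hS : ∀ v, v ∈ M ∩ M' ↔ v ∈ A ∨ v ∈ T)
    (hadj : ∀ u v, G.Adj u v → (u ∈ M ∧ v ∈ M) ∨ (u ∈ M' ∧ v ∈ M'))
    (hA : A.Nonempty) (hAind : ∀ u ∈ A, ∀ v ∈ A, ¬ G.Adj u v)
    (ht : 3 ≤ t) (hTt : T.card ≤ t) (hk : A.card + T.card + 2 ^ (t - 1) ≤ (k - 1) + 1 + t)
    {c : V → Fin (k - 1)} {a : Fin (k - 1)} (hc : G.IsMonoColoring M A T c a)
    (hmax : ∀ (c' : V → Fin (k - 1)) (a' : Fin (k - 1)), G.IsMonoColoring M A T c' a' →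
      (T.image c').card ≤ (T.image c).card)
    {x₀ y₀ : V} (hx₀ : x₀ ∈ T) (hy₀ : y₀ ∈ T) (hne₀ : x₀ ≠ y₀) (hc₀ : c x₀ = c y₀) :
    G.Colorable (k - 1) := by
  classical
  have hT : (T : Set V) ⊆ M := fun x hx => ((hS x).2 (.inr hx)).1
  obtain ⟨𝓤, hsub, htwo, hfull, hcard⟩ :=
    exists_label_family T c ht hTt hk hx₀ hy₀ hne₀ hc₀
  have haP : a ∉ T.image c := by
    intro h
    obtain ⟨x, hx, h⟩ := Finset.mem_image.1 h
    exact hc.ne_of_mem x hx h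
  obtain ⟨ℓ, H, hinj, hℓ, hℓa, hH, hHP, hHℓ⟩ :=
    exists_labels (T.image c) haP 𝓤 (Finset.card_pos.2 hA) (by simpa using hcard)
  obtain ⟨b, hb1, hb2, hb3, hb4⟩ := exists_blocks (G := G) hT 𝓤 ℓ (c x₀) hsub htwo hinj hℓ hℓa hfull
    (fun l hl hla x hx y hy hxy => hc.reachable_of_max hT hmax hl hla hx hy hxy)
  have hF : G.blockGraph M b ≠ ⊥ := by
    intro h
    have h1 := hb3 x₀ y₀ _ (hb2 x₀ hx₀) (by rw [hb2 y₀ hy₀, hc₀])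
    rw [h, reachable_bot] at h1
    exact hne₀ h1
  -- The value `none` of `b` also counts as a block, so the components of the rest of `M` are
  -- contracted as well.
  obtain ⟨c', hc'1, hc'2⟩ := hG.exists_contract_coloring (G.blockGraph M b) (fun _ _ h => h.1) hF
  have : Nonempty (Fin (k - 1)) := ⟨a⟩
  obtain ⟨c'', hc'', hcc⟩ := hc.exists_transfer hT 𝓤 ℓ htwo hinj hℓ hℓa b hb1 hb2 hb4 H hH hHP hHℓ c'
    (fun v w p hv hw => hc'1 v w (hb3 v w p hv hw))
    (fun v hv w hw h hbv hbw =>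
      hc'1 v w (Adj.reachable (G := G.blockGraph M b) ⟨h, hv, hw, hbv.trans hbw.symm⟩))
    (fun v _ w _ h hne => hc'2 v w h fun hr => hne hr.block_eq)
  have hAb : ∀ x ∈ A, b x = none := by
    intro x hx
    have hxa := hc.eq_of_mem x hx
    cases h : b x with
    | none => rfl
    | some p =>
      obtain ⟨-, hp, h1 | ⟨U, hU, -, h1⟩⟩ := hb1 x p h
      · exact (haP (hxa ▸ h1 ▸ hp)).elim
      · exact (hℓa U hU (h1.symm.trans hxa)).elim
  refine colorable_of_glue hadj c'' c' hc'' ?_ fun u hu v hv => hcc u ((hS u).1 hu) v ((hS v).1 hv)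
  -- An edge of `M'` lost in the contraction would have both ends in `A ∪ T` and in one block. This
  -- is impossible, since `A` is independent and `c` is proper on `T`.
  intro u hu v hv huv
  refine hc'2 u v huv fun hr => ?_
  have hvM := hr.mem_of_ne huv.ne
  have huM := hr.symm.mem_of_ne huv.ne'
  have hbb := hr.block_eq
  rcases (hS u).1 ⟨huM, hu⟩ with hu' | hu' <;> rcases (hS v).1 ⟨hvM, hv⟩ with hv' | hv'
  · exact hAind u hu' v hv' huv
  · rw [hAb u hu', hb2 v hv'] at hbb; simp at hbb
  · rw [hAb v hv', hb2 u hu'] at hbb; simp at hbb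
  · rw [hb2 u hu', hb2 v hv', Option.some.injEq] at hbb
    exact hc.proper u huM v hvM huv hbb

/-- Contracting `A` together with a connected set that lies outside `M` and is attached to all of
`A ∪ T` gives a colouring of `M` in which `A` is a colour class of `A ∪ T`. -/
theorem IsContractionCritical.exists_isMonoColoring [Finite V] {G : SimpleGraph V} {k : ℕ}
    (hG : G.IsContractionCritical k) {M D : Set V} {A T : Finset V} (hAT : Disjoint A T)
    (hTM : ∀ x ∈ T, x ∈ M) (hDM : ∀ x ∈ D, x ∉ M)
    (hA : A.Nonempty) (hAind : ∀ u ∈ A, ∀ v ∈ A, ¬ G.Adj u v)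
    (hD : ∀ u ∈ D, ∀ v ∈ D, (G.onSet D).Reachable u v)
    (hDA : ∀ x ∈ A, ∃ d ∈ D, G.Adj d x) (hDT : ∀ x ∈ T, ∃ d ∈ D, G.Adj d x) :
    ∃ (c : V → Fin (k - 1)) (a : Fin (k - 1)), G.IsMonoColoring M A T c a := by
  set F := G.onSet (D ∪ A) with hF
  obtain ⟨x₀, hx₀⟩ := hA
  obtain ⟨d₀, hd₀, hd₀x₀⟩ := hDA x₀ hx₀
  have hFbot : F ≠ ⊥ := by
    intro h
    have : F.Adj d₀ x₀ := ⟨hd₀x₀, .inl hd₀, .inr hx₀⟩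
    rw [h] at this
    exact this
  obtain ⟨c, hc1, hc2⟩ := hG.exists_contract_coloring F (fun _ _ h => h.1) hFbot
  have hDF : ∀ u ∈ D, F.Reachable d₀ u := fun u hu =>
    (hD d₀ hd₀ u hu).mono (onSet_mono G Set.subset_union_left)
  have hFmem : ∀ u v, F.Reachable u v → u ≠ v → v ∈ D ∪ (A : Set V) := fun u v h hne =>
    (h.of_closed (fun w => w = u ∨ w ∈ D ∪ (A : Set V)) (.inl rfl)
      fun _ _ h _ => .inr h.2.2).resolve_left hne.symm
  refine ⟨c, c d₀, ⟨?_, ?_, ?_⟩⟩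
  · intro u hu v hv huv
    refine hc2 u v huv fun hr => ?_
    refine hAind u ?_ v ?_ huv
    · exact (hFmem v u hr.symm huv.ne').resolve_left fun h => hDM u h hu
    · exact (hFmem u v hr huv.ne).resolve_left fun h => hDM v h hv
  · intro x hx
    obtain ⟨d, hd, hdx⟩ := hDA x hx
    refine (hc1 d₀ x ((hDF d hd).trans (Adj.reachable (G := F) ⟨hdx, .inl hd, .inr hx⟩))).symm
  · intro x hx
    obtain ⟨d, hd, hdx⟩ := hDT x hx
    rw [hc1 d₀ d (hDF d hd)]
    refine (hc2 d x hdx fun hr => ?_).symm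
    rcases hFmem d x hr hdx.ne with h | h
    · exact hDM x h (hTM x hx)
    · exact Finset.disjoint_left.1 hAT h hx

theorem exists_max_isMonoColoring [Finite V] {G : SimpleGraph V} {n : ℕ} {M : Set V}
    {A T : Finset V} (h : ∃ (c : V → Fin n) (a : Fin n), G.IsMonoColoring M A T c a) :
    ∃ (c : V → Fin n) (a : Fin n), G.IsMonoColoring M A T c a ∧
      ∀ (c' : V → Fin n) (a' : Fin n), G.IsMonoColoring M A T c' a' →
        (T.image c').card ≤ (T.image c).card := by
  obtain ⟨c, ⟨a, hc⟩, hmax⟩ := Set.exists_max_image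
    {c : V → Fin n | ∃ a, G.IsMonoColoring M A T c a} (fun c => (T.image c).card) (Set.toFinite _) h
  exact ⟨c, a, hc, fun c' a' h' => hmax c' ⟨a', h'⟩⟩

/-- The right-hand side does not mention `c`, so injective colourings of the two sides agree on `A ∪
T` up to renaming. -/
theorem IsMonoColoring.eq_iff {G : SimpleGraph V} {M : Set V} {A T : Finset V} {c : V → α} {a : α}
    (hc : G.IsMonoColoring M A T c a) (hinj : Set.InjOn c T) {u v : V} (hu : u ∈ A ∨ u ∈ T)
    (hv : v ∈ A ∨ v ∈ T) : c u = c v ↔ u = v ∨ (u ∈ A ∧ v ∈ A) := by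
  constructor
  · intro h
    rcases hu with hu | hu <;> rcases hv with hv | hv
    · exact .inr ⟨hu, hv⟩
    · exact (hc.ne_of_mem v hv (h ▸ hc.eq_of_mem u hu)).elim
    · exact (hc.ne_of_mem u hu (h ▸ hc.eq_of_mem v hv)).elim
    · exact .inl (hinj hu hv h)
  · rintro (rfl | ⟨hu, hv⟩)
    · rfl
    · rw [hc.eq_of_mem u hu, hc.eq_of_mem v hv]

/-- If a `k`-contraction-critical graph has a separation along `A ∪ T`, with `A` independent, both of
whose sides contain a connected set attached to all of `A ∪ T`, then it is `(k - 1)`-colourable. -/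
theorem IsContractionCritical.colorable_of_separation [Finite V] {G : SimpleGraph V}
    {k t : ℕ} (hG : G.IsContractionCritical k) {M M' D D' : Set V} {A T : Finset V}
    (hS : ∀ v, v ∈ M ∩ M' ↔ v ∈ A ∨ v ∈ T)
    (hadj : ∀ u v, G.Adj u v → (u ∈ M ∧ v ∈ M) ∨ (u ∈ M' ∧ v ∈ M'))
    (hAT : Disjoint A T) (hA : A.Nonempty) (hAind : ∀ u ∈ A, ∀ v ∈ A, ¬ G.Adj u v)
    (ht : 3 ≤ t) (hTt : T.card ≤ t) (hk : A.card + T.card + 2 ^ (t - 1) ≤ (k - 1) + 1 + t)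
    (hDM : ∀ x ∈ D, x ∉ M') (hDM' : ∀ x ∈ D', x ∉ M)
    (hD : ∀ u ∈ D, ∀ v ∈ D, (G.onSet D).Reachable u v)
    (hD' : ∀ u ∈ D', ∀ v ∈ D', (G.onSet D').Reachable u v)
    (hDS : ∀ x, x ∈ A ∨ x ∈ T → ∃ d ∈ D, G.Adj d x)
    (hDS' : ∀ x, x ∈ A ∨ x ∈ T → ∃ d ∈ D', G.Adj d x) : G.Colorable (k - 1) := by
  obtain ⟨c, a, hc, hmax⟩ := exists_max_isMonoColoring (hG.exists_isMonoColoring (M := M) hAT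
    (fun x hx => ((hS x).2 (.inr hx)).1) hDM' hA hAind hD'
    (fun x hx => hDS' x (.inl hx)) (fun x hx => hDS' x (.inr hx)))
  obtain ⟨c', a', hc', hmax'⟩ := exists_max_isMonoColoring (hG.exists_isMonoColoring (M := M') hAT
    (fun x hx => ((hS x).2 (.inr hx)).2) hDM hA hAind hD
    (fun x hx => hDS x (.inl hx)) (fun x hx => hDS x (.inr hx)))
  by_cases hi : Set.InjOn c T
  · by_cases hi' : Set.InjOn c' T
    · refine colorable_of_glue hadj c c' hc.proper hc'.proper fun u hu v hv => ?_
      rw [hc.eq_iff hi ((hS u).1 hu) ((hS v).1 hv), hc'.eq_iff hi' ((hS u).1 hu) ((hS v).1 hv)]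
    · simp only [Set.InjOn, not_forall] at hi'
      obtain ⟨x, hx, y, hy, hxy, hne⟩ := hi'
      exact hG.colorable_of_max (fun v => by rw [Set.inter_comm]; exact hS v)
        (fun u v h => (hadj u v h).symm) hA hAind ht hTt hk hc' hmax' hx hy hne hxy
  · simp only [Set.InjOn, not_forall] at hi
    obtain ⟨x, hx, y, hy, hxy, hne⟩ := hi
    exact hG.colorable_of_max hS hadj hA hAind ht hTt hk hc hmax hx hy hne hxy

/-! ### Minimal separators -/

/-- The vertices reachable from `u` without using `S₀` are attached to all of `S₀` when `S₀` is
minimal with the property that it separates `u` from `v`. -/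
theorem exists_adj_of_minimal [DecidableEq V] {G : SimpleGraph V} {S₀ : Finset V} {u v : V}
    (hu : u ∉ S₀) (hv : ¬ (G.onSet (S₀ : Set V)ᶜ).Reachable u v) {s : V}
    (hmin : (G.onSet ((S₀.erase s : Finset V) : Set V)ᶜ).Reachable u v) :
    ∃ d ∈ G.reachSet (S₀ : Set V)ᶜ {u}, G.Adj d s := by
  by_contra hno
  push Not at hno
  have hsub : G.reachSet (S₀ : Set V)ᶜ {u} ⊆ (S₀ : Set V)ᶜ := reachSet_subset (by simpa using hu)
  have : v ∈ G.reachSet (S₀ : Set V)ᶜ {u} := by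
    refine hmin.of_closed (· ∈ G.reachSet (S₀ : Set V)ᶜ {u}) (subset_reachSet _ _ _ rfl) ?_
    rintro x y ⟨hxy, -, hy⟩ hx
    refine mem_reachSet_of_adj hx (hsub hx) (fun hyS => hy ?_) hxy
    refine Finset.mem_coe.2 (Finset.mem_erase.2 ⟨?_, hyS⟩)
    rintro rfl
    exact hno x hx hxy
  obtain ⟨x, rfl, h⟩ := this
  exact hv h

theorem reachable_onSet_of_mem_reachSet_singleton {G : SimpleGraph V} {N : Set V} {u x y : V}
    (hx : x ∈ G.reachSet N {u}) (hy : y ∈ G.reachSet N {u}) :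
    (G.onSet (G.reachSet N {u})).Reachable x y := by
  obtain ⟨_, rfl, hx⟩ := hx
  obtain ⟨u, rfl, hy⟩ := hy
  exact (reachable_onSet_reachSet (Set.mem_singleton u) hx).symm.trans
    (reachable_onSet_reachSet (Set.mem_singleton u) hy)

/-- A proper induced subgraph of a `k`-contraction-critical graph is `(k - 1)`-colourable. -/
theorem IsContractionCritical.exists_isProperOn [Finite V] {G : SimpleGraph V} {k : ℕ}
    (hG : G.IsContractionCritical k) {M : Set V} {x : V} (hx : x ∈ M) (hM : M ≠ Set.univ) :
    ∃ c : V → Fin (k - 1), G.IsProperOn M c := by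
  obtain ⟨c, h0, -, h2⟩ := hG.exists_coloring M ⊥ bot_le (fun _ _ h => h.elim) (.inl hM)
  obtain ⟨i, -⟩ := Option.ne_none_iff_exists'.1 (h0 x hx)
  refine ⟨fun v => (c v).getD i, fun u hu v hv huv h => ?_⟩
  obtain ⟨p, hp⟩ := Option.ne_none_iff_exists'.1 (h0 u hu)
  obtain ⟨q, hq⟩ := Option.ne_none_iff_exists'.1 (h0 v hv)
  refine h2 u hu v hv huv (fun hr => huv.ne (reachable_bot.1 hr)) ?_
  simp only [hp, hq, Option.getD_some] at h
  rw [hp, hq, h]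

/-- If two vertices of a `k`-contraction-critical graph are separated by a set `S` that is independent
up to `t` vertices and has at most `k - 2 ^ (t - 1) + t` vertices, then the graph is
`(k - 1)`-colourable. -/
theorem IsContractionCritical.colorable_of_not_reachable [Finite V] [DecidableEq V]
    {G : SimpleGraph V} {k t : ℕ} (hG : G.IsContractionCritical k) (ht : 3 ≤ t) {S A : Finset V}
    (hk : S.card + 2 ^ (t - 1) ≤ (k - 1) + 1 + t) (hAind : ∀ u ∈ A, ∀ v ∈ A, ¬ G.Adj u v)
    (hAS : (S \ A).card ≤ t) {u v : V} (hu : u ∉ S) (hv : v ∉ S)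
    (huv : ¬ (G.onSet (S : Set V)ᶜ).Reachable u v) : G.Colorable (k - 1) := by
  obtain ⟨S₀, hS₀S, hsep, hmin⟩ := exists_minimal_le_of_wellFoundedLT
    (fun S₀ : Finset V => ¬ (G.onSet (S₀ : Set V)ᶜ).Reachable u v) S huv
  replace hu : u ∉ S₀ := fun h => hu (hS₀S h)
  replace hv : v ∉ S₀ := fun h => hv (hS₀S h)
  have hmin' : ∀ s ∈ S₀, (G.onSet ((S₀.erase s : Finset V) : Set V)ᶜ).Reachable u v := by
    intro s hs
    by_contra h
    exact Finset.notMem_erase s S₀ (hmin h (Finset.erase_subset s S₀) hs)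
  set N : Set V := (S₀ : Set V)ᶜ with hN
  set D := G.reachSet N {u} with hD
  set D' := G.reachSet N {v} with hD'
  have hDN : D ⊆ N := reachSet_subset (by simpa [hN] using hu)
  have hDN' : D' ⊆ N := reachSet_subset (by simpa [hN] using hv)
  have hDD : ∀ x ∈ D', x ∉ D := by
    rintro x ⟨_, rfl, hx⟩ ⟨_, rfl, hx'⟩
    exact hsep (hx'.trans hx.symm)
  have hadj : ∀ x y, G.Adj x y → (x ∈ D ∪ S₀ ∧ y ∈ D ∪ S₀) ∨ (x ∈ Dᶜ ∧ y ∈ Dᶜ) := by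
    have key : ∀ x y, G.Adj x y → x ∈ D → y ∈ D ∪ (S₀ : Set V) := by
      intro x y hxy hx
      by_cases hy : y ∈ S₀
      · exact .inr hy
      · exact .inl (mem_reachSet_of_adj hx (hDN hx) hy hxy)
    intro x y hxy
    by_cases hx : x ∈ D
    · exact .inl ⟨.inl hx, key x y hxy hx⟩
    · by_cases hy : y ∈ D
      · exact .inl ⟨key y x hxy.symm hy, .inl hy⟩
      · exact .inr ⟨hx, hy⟩
  have hinter : ∀ x, x ∈ (D ∪ S₀) ∩ Dᶜ ↔ x ∈ S₀ := by
    intro x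
    refine ⟨fun h => h.1.resolve_left h.2, fun h => ⟨.inr h, fun hx => hDN hx h⟩⟩
  have huD : u ∈ D := subset_reachSet _ _ _ rfl
  have hvD : v ∉ D := hDD v (subset_reachSet _ _ _ rfl)
  -- An empty separator leaves no vertex for `A`; here the two sides are proper induced subgraphs
  -- with nothing in common.
  rcases S₀.eq_empty_or_nonempty with hS₀ | ⟨s₀, hs₀⟩
  · have hM : D ∪ (S₀ : Set V) ≠ Set.univ := by
      intro h
      have : v ∈ D ∪ (S₀ : Set V) := h ▸ Set.mem_univ v
      exact this.elim hvD hv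
    have hM' : Dᶜ ≠ Set.univ := by
      intro h
      have : u ∈ Dᶜ := h ▸ Set.mem_univ u
      exact this huD
    obtain ⟨c, hc⟩ := hG.exists_isProperOn (.inl huD) hM
    obtain ⟨c', hc'⟩ := hG.exists_isProperOn (M := Dᶜ) hvD hM'
    refine colorable_of_glue hadj c c' hc hc' fun x hx => ?_
    have := (hinter x).1 hx
    simp [hS₀] at this
  · obtain ⟨A₀, hA₀S, hA₀, hA₀ind, hA₀t⟩ : ∃ A₀ : Finset V, A₀ ⊆ S₀ ∧ A₀.Nonempty ∧
        (∀ x ∈ A₀, ∀ y ∈ A₀, ¬ G.Adj x y) ∧ (S₀ \ A₀).card ≤ t := by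
      by_cases hne : (A ∩ S₀).Nonempty
      · refine ⟨A ∩ S₀, Finset.inter_subset_right, hne, fun x hx y hy =>
          hAind x (Finset.mem_inter.1 hx).1 y (Finset.mem_inter.1 hy).1,
          (Finset.card_le_card fun x hx => ?_).trans hAS⟩
        obtain ⟨hx, hx'⟩ := Finset.mem_sdiff.1 hx
        exact Finset.mem_sdiff.2 ⟨hS₀S hx, fun h => hx' (Finset.mem_inter.2 ⟨h, hx⟩)⟩
      -- When `A` misses `S₀`, all of `S₀` lies in `S \ A` and has at most `t` vertices, so any
      -- single vertex can serve as the independent set.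
      · refine ⟨{s₀}, by simpa using hs₀, Finset.singleton_nonempty _, ?_,
          (Finset.card_le_card fun x hx => ?_).trans hAS⟩
        · simp
        · have hx := (Finset.mem_sdiff.1 hx).1
          exact Finset.mem_sdiff.2 ⟨hS₀S hx, fun h => hne ⟨x, Finset.mem_inter.2 ⟨h, hx⟩⟩⟩
    have hmem : ∀ x, x ∈ A₀ ∨ x ∈ S₀ \ A₀ ↔ x ∈ S₀ := by
      intro x
      rw [← Finset.mem_union, Finset.union_sdiff_of_subset hA₀S]
    refine hG.colorable_of_separation (M := D ∪ S₀) (M' := Dᶜ) (D := D) (D' := D') (A := A₀)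
      (T := S₀ \ A₀) (fun x => (hinter x).trans (hmem x).symm) hadj Finset.disjoint_sdiff hA₀ hA₀ind
      ht hA₀t ?_ (fun x hx h => h hx) (fun x hx h => h.elim (hDD x hx) (hDN' hx))
      (fun x hx y hy => reachable_onSet_of_mem_reachSet_singleton hx hy)
      (fun x hx y hy => reachable_onSet_of_mem_reachSet_singleton hx hy)
      (fun x hx => exists_adj_of_minimal hu hsep (hmin' x ((hmem x).1 hx)))
      (fun x hx => exists_adj_of_minimal hv (fun h => hsep h.symm) (hmin' x ((hmem x).1 hx)).symm)
    have h1 := Finset.card_le_card hS₀S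
    have h2 := Finset.card_sdiff_add_card_eq_card hA₀S
    omega

end SimpleGraph

/-! ### The theorem -/

theorem theorem5 {V : Type*} [Finite V] (G : SimpleGraph V) (k s t : ℕ)
    (hk : 1 ≤ k) (ht : 3 ≤ t) (hkst : (s : ℤ) + 2 ^ (t - 1) - t ≤ k)
    (hG : G.IsContractionCritical k) (S : Finset V) (hS : S.card ≤ s)
    (hα : (S.card : ℤ) - t ≤ (G.induce (S : Set V)).indepNum) :
    (G.induce (S : Set V)ᶜ).Connected := by
  classical
  -- This forces `s < k`. Hence `S` is not the whole vertex set, as `G` would otherwise have at most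
  -- `k - 1` vertices.
  have ht2 : t < 2 ^ (t - 1) := by
    obtain ⟨r, rfl⟩ := Nat.exists_eq_add_of_le ht
    have : r < 2 ^ r := Nat.lt_two_pow_self
    rw [show 3 + r - 1 = r + 2 by omega, pow_add]
    omega
  have hkN : s + 2 ^ (t - 1) ≤ (k - 1) + 1 + t := by
    have h1 : k - 1 + 1 = k := by omega
    rw [h1]
    zify
    linarith
  have hnot : ¬ G.Colorable (k - 1) := by
    intro h
    have h1 := h.chromaticNumber_le
    rw [hG.1] at h1
    have h2 : k ≤ k - 1 := by exact_mod_cast h1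
    omega
  have hne : Nonempty ((S : Set V)ᶜ : Set V) := by
    by_contra hemp
    rw [Set.nonempty_coe_sort, Set.not_nonempty_iff_eq_empty, Set.compl_empty_iff] at hemp
    have := Fintype.ofFinite V
    refine hnot (G.colorable_of_fintype.mono ?_)
    have h1 : S = Finset.univ := by
      ext x; simp [← Finset.mem_coe, hemp]
    rw [← Finset.card_univ, ← h1]
    omega
  refine (SimpleGraph.connected_iff _).2 ⟨fun x y => ?_, hne⟩
  by_contra hxy
  obtain ⟨B, hB⟩ := (G.induce (S : Set V)).exists_isNIndepSet_indepNum
  refine hnot (hG.colorable_of_not_reachable ht (S := S) (A := B.map (Function.Embedding.subtype _))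
    (by omega) ?_ ?_ (u := x) (v := y) x.2 y.2 fun h => hxy ?_)
  · intro u hu v hv huv
    obtain ⟨u, hu', rfl⟩ := Finset.mem_map.1 hu
    obtain ⟨v, hv', rfl⟩ := Finset.mem_map.1 hv
    exact hB.1 hu' hv' (fun h => huv.ne (congrArg _ h)) huv
  · have hsub : B.map (Function.Embedding.subtype _) ⊆ S := by
      intro u hu
      obtain ⟨u, -, rfl⟩ := Finset.mem_map.1 hu
      exact u.2
    rw [Finset.card_sdiff_of_subset hsub, Finset.card_map, hB.2]
    omega
  · obtain ⟨hy, h'⟩ := h.of_closed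
      (fun w => ∃ hw : w ∈ (S : Set V)ᶜ, (G.induce (S : Set V)ᶜ).Reachable x ⟨w, hw⟩)
      ⟨x.2, SimpleGraph.Reachable.refl _⟩ fun a b hab ⟨ha, hr⟩ =>
        ⟨hab.2.2, hr.trans (SimpleGraph.Adj.reachable (G := G.induce (S : Set V)ᶜ) hab.1)⟩
    exact h'
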